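/- Let $N,m\ge 1$ and let $T_1,\dots,T_m$ be non-singular linear maps on $\mathbb R^N$ with $\|T_i\|<1$. For a linear map $T$ with singular values $\alpha_1\ge\dots\ge\alpha_N$ put $\phi^s(T)=\alpha_1\cdots\alpha_{j-1}\alpha_j^{\,s-j+1}$ if $0<s\le N$ and $j$ is the integer with $j-1<s\le j$, and $\phi^s(T)=(\alpha_1\cdots\alpha_N)^{s/N}$ if $s>N$. For a finite word $u=(u_1,\dots,u_k)$ over $\{1,\dots,m\}$ write $|u|=k$ and $T_u=T_{u_1}\cdots T_{u_k}$, and let $C_u$ be the set of all infinite words in $I_\infty=\{1,\dots,m\}^{\mathbb N}$ that begin with $u$. For distinct $x,y\in I_\infty$ let $x\wedge y$ be their longest common initial word. The join set of distinct $x_1,\dots,x_r\in I_\infty$ consists of the words $x_a\wedge x_b$ $(a\ne b)$, where $v$ is counted with multiplicity $t-1$, $t$ being the largest number of words among the $x_a$ whose pairwise joins all equal $v$; it has $r-1$ elements $v_1,\dots,v_{r-1}$, counted with multiplicity, and we put $\phi^s(x_1,\dots,x_r)=\phi^s(T_{v_1})\cdots\phi^s(T_{v_{r-1}})$. If the $x_a$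 are not distinct, put $\phi^s(x_1,\dots,x_r)=0$ and $\phi^s(x_1,\dots,x_r)^{-1}=\infty$. Let $\mu$ be a finite Borel measure on $I_\infty$, let $q>1$, and let $n$ be an integer with $q-1\le n\le q$. Let $s>0$ be such that $\sum_{|u|=k}\phi^s(T_u)^{1-q}\mu(C_u)^q$ decays geometrically in $k$, that is, there are $c>0$ and $0<\lambda<1$ with $$\sum_{|u|=k}\phi^s(T_u)^{1-q}\mu(C_u)^q\le c\lambda^k\qquad\text{for all }k\ge 0.$$ Then $$\int\Big[\int\cdots\int\phi^s(i_1,\dots,i_n,j)^{-1}\,d\mu(i_1)\cdots d\mu(i_n)\Big]^{(q-1)/n}d\mu(j)<\infty .$$ -/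

import Mathlib

open MeasureTheory
open scoped ENNReal

noncomputable section

namespace AlmostSelfAffine

/-- The singular value function `φ^s(T)` of a linear map `T` on `ℝ^N`. Mathlib's singular values
are listed in decreasing order and indexed from `0`, so that `α_i(T)` is `singularValues (i - 1)`.
For `0 < s ≤ N` and `j = ⌈s⌉` (so `j - 1 < s ≤ j`) it is `α_1 ⋯ α_{j-1} α_j^{s-j+1}`; for `s > N`
it is `(α_1 ⋯ α_N)^{s/N}`. -/
def svf {N : ℕ} (s : ℝ) (T : EuclideanSpace ℝ (Fin N) →L[ℝ] EuclideanSpace ℝ (Fin N)) : ℝ :=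
  if s ≤ 0 then 1
  else if s ≤ N then
    (∏ i ∈ Finset.range (⌈s⌉₊ - 1), T.toLinearMap.singularValues i) *
      T.toLinearMap.singularValues (⌈s⌉₊ - 1) ^ (s - (⌈s⌉₊ : ℝ) + 1)
  else (∏ i ∈ Finset.range N, T.toLinearMap.singularValues i) ^ (s / (N : ℝ))

/-- The code space `I_∞` of infinite words over the alphabet `{1, …, m}`; its (product) σ-algebra
is the Borel σ-algebra. -/
abbrev Code (m : ℕ) : Type := ℕ → Fin m

/-- The finite words over the alphabet `{1, …, m}`. -/
abbrev Word (m : ℕ) : Type := List (Fin m)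

/-- The curtailment `x|_k = (x_1, …, x_k)` of an infinite word. -/
def curtail {m : ℕ} (x : Code m) (k : ℕ) : Word m := List.ofFn fun i : Fin k => x i

/-- The cylinder `C_u` of all infinite words that begin with `u`. -/
def cyl {m : ℕ} (u : Word m) : Set (Code m) := {x | curtail x u.length = u}

/-- The product `T_u = T_{u_1} T_{u_2} ⋯ T_{u_k}`, the identity if `u` is empty. -/
def wordMap {N m : ℕ} (T : Fin m → EuclideanSpace ℝ (Fin N) →L[ℝ] EuclideanSpace ℝ (Fin N))
    (u : Word m) : EuclideanSpace ℝ (Fin N) →L[ℝ] EuclideanSpace ℝ (Fin N) :=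
  (u.map T).prod

/-- The moment sum `∑_{|u| = k} φ^s(T_u)^{1-q} μ(C_u)^q`. -/
def momentSum {N m : ℕ} (T : Fin m → EuclideanSpace ℝ (Fin N) →L[ℝ] EuclideanSpace ℝ (Fin N))
    (μ : Measure (Code m)) (s q : ℝ) (k : ℕ) : ℝ :=
  ∑ u : Fin k → Fin m,
    svf s (wordMap T (List.ofFn u)) ^ (1 - q) * μ.real (cyl (List.ofFn u)) ^ q

/-- The join `x ∧ y`, the longest common initial word of two distinct infinite words. (The join of
two equal infinite words is not a finite word; this function is used only for distinct ones.) -/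
def join {m : ℕ} (x y : Code m) : Word m := curtail x (PiNat.firstDiff x y)

open Classical in
/-- The set of the join points `x_p ∧ x_q`, `p ≠ q`, of distinct infinite words, without
multiplicities. -/
def joinPoints {m n : ℕ} (x : Fin n → Code m) : Finset (Word m) :=
  (Finset.univ.filter fun p : Fin n × Fin n => p.1 ≠ p.2).image fun p => join (x p.1) (x p.2)

open Classical in
/-- The multiplicity `r - 1` of a join point `v`, where `r` is the greatest number of words among
the `x_p` whose pairwise joins all equal `v`. -/
def joinMult {m n : ℕ} (x : Fin n → Code m) (v : Word m) : ℕ :=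
  (Finset.univ.filter fun A : Finset (Fin n) =>
    ∀ p ∈ A, ∀ q ∈ A, p ≠ q → join (x p) (x q) = v).sup Finset.card - 1

open Classical in
/-- The multienergy kernel `φ^s(x_1, …, x_n)`, the product of `φ^s(T_v)` over the join set of
`x_1, …, x_n`, counted with multiplicity. If two of the words coincide, then their join is an
infinite word, along which `φ^s(T_v)` tends to `0`, and the kernel is `0`. -/
def multiKernel {N m n : ℕ} (T : Fin m → EuclideanSpace ℝ (Fin N) →L[ℝ] EuclideanSpace ℝ (Fin N))
    (s : ℝ) (x : Fin n → Code m) : ℝ :=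
  if Function.Injective x then ∏ v ∈ joinPoints x, svf s (wordMap T v) ^ joinMult x v else 0

/-- The multienergy integral
`∫ [∫ ⋯ ∫ φ^s(i_1, …, i_n, j)⁻¹ dμ(i_1) ⋯ dμ(i_n)]^{(q-1)/n} dμ(j)`, with values in `[0, ∞]`;
the integrand is `∞` where the kernel vanishes. -/
def multiEnergy {N m : ℕ} (T : Fin m → EuclideanSpace ℝ (Fin N) →L[ℝ] EuclideanSpace ℝ (Fin N))
    (μ : Measure (Code m)) (s q : ℝ) (n : ℕ) : ℝ≥0∞ :=
  ∫⁻ j, (∫⁻ i : Fin n → Code m,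
      (ENNReal.ofReal (multiKernel T s (Fin.snoc (α := fun _ => Code m) i j)))⁻¹
        ∂(Measure.pi fun _ => μ)) ^ ((q - 1) / (n : ℝ)) ∂μ

end AlmostSelfAffine

end

noncomputable section

namespace AlmostSelfAffine

/-! ### The singular value function -/

section SingularValues

variable {N : ℕ}

/-! Put p = q - 1 and h(u) = φ^s(T_u)⁻¹. Adjoining a word to a family adds exactly one join point,
its longest join with the others (`joinMult_succ`). Peeling words off one at a time bounds the
reciprocal kernel by a sum over trees rooted at j of products, over the edges, of two-word kernels
that sum h along all common initial words (`inv_multiKernel_le_treeWeight`). Such products integrate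
leaf by leaf: a leaf carrying a weight F becomes the potential of F at its parent.

Potentials are controlled by counting edges. Say F has degree e if F ≤ C H^(e/p) with H integrable.
Degrees add under products, and a potential raises the degree by one (`WeightBound.potential`):
Jensen on cylinders, valid for e ≤ p, leaves ∑_k a_k E_k^(e/p), where a_k = h μ(C) and E_k is the
average of H over the cylinder C of length k. Here ∫ a_k^p is the moment sum, which decays
geometrically, and ∫ E_k ≤ ∫ H; part of the decay pays for pointwise bounds and the rest for the sum
over k. After n edges the inner integral is at most C H^(n/p), whose power p/n is integrable. Every
potential is applied to degree at most n - 1, so n ≤ q suffices. -/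

theorem singularValues_le_norm (T : EuclideanSpace ℝ (Fin N) →L[ℝ] EuclideanSpace ℝ (Fin N))
    (i : ℕ) : T.toLinearMap.singularValues i ≤ ‖T‖ := by
  rcases lt_or_ge i (Module.finrank ℝ (EuclideanSpace ℝ (Fin N))) with hi | hi
  -- An eigenvector v of T*T for the eigenvalue α_i² satisfies ‖T v‖ = α_i ‖v‖.
  · obtain ⟨v, hv⟩ :=
      (T.toLinearMap.hasEigenvalue_adjoint_comp_self_sq_singularValues hi).exists_hasEigenvector
    have hv0 : 0 < ‖v‖ := norm_pos_iff.2 hv.2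
    have h1 : ‖T v‖ ^ 2 = T.toLinearMap.singularValues i ^ 2 * ‖v‖ ^ 2 := by
      have h2 := hv.apply_eq_smul
      have h3 : inner ℝ (T v) (T v) = inner ℝ v ((LinearMap.adjoint T.toLinearMap ∘ₗ
          T.toLinearMap) v) := by
        rw [LinearMap.comp_apply, LinearMap.adjoint_inner_right]; rfl
      rw [← real_inner_self_eq_norm_sq, h3, h2, ← real_inner_self_eq_norm_sq]
      exact inner_smul_right _ _ _
    have h4 : ‖T v‖ ^ 2 ≤ (‖T‖ * ‖v‖) ^ 2 := by
      gcongr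
      exact T.le_opNorm v
    rw [h1, ← mul_pow] at h4
    have h5 := le_of_sq_le_sq h4 (by positivity)
    exact le_of_mul_le_mul_right h5 hv0
  · rw [LinearMap.singularValues_of_finrank_le _ hi]
    exact norm_nonneg _

theorem svf_le_one {s : ℝ} {T : EuclideanSpace ℝ (Fin N) →L[ℝ] EuclideanSpace ℝ (Fin N)}
    (hT : ‖T‖ ≤ 1) : svf s T ≤ 1 := by
  have h0 := T.toLinearMap.singularValues_nonneg
  have h1 : ∀ i, T.toLinearMap.singularValues i ≤ 1 :=
    fun i => (singularValues_le_norm T i).trans hT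
  have hprod : ∀ k, ∏ i ∈ Finset.range k, T.toLinearMap.singularValues i ≤ 1 :=
    fun k => Finset.prod_le_one (fun i _ => h0 i) fun i _ => h1 i
  have hprod0 : ∀ k, 0 ≤ ∏ i ∈ Finset.range k, T.toLinearMap.singularValues i :=
    fun k => Finset.prod_nonneg fun i _ => h0 i
  unfold svf
  split_ifs with hs hsN
  · exact le_rfl
  · refine mul_le_one₀ (hprod _) (Real.rpow_nonneg (h0 _) _) (Real.rpow_le_one (h0 _) (h1 _) ?_)
    have := Nat.ceil_lt_add_one (not_le.1 hs).le
    linarith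
  · exact Real.rpow_le_one (hprod0 _) (hprod _)
      (div_nonneg (not_le.1 hs).le (Nat.cast_nonneg _))

theorem svf_pos (s : ℝ) {T : EuclideanSpace ℝ (Fin N) →L[ℝ] EuclideanSpace ℝ (Fin N)}
    (hT : Function.Injective T) : 0 < svf s T := by
  have h0 : ∀ i < N, 0 < T.toLinearMap.singularValues i := by
    have := (T.toLinearMap.injective_iff_forall_lt_finrank_singularValues_pos).1 hT
    simpa using this
  unfold svf
  split_ifs with hs hsN
  · exact one_pos
  · have hc : ⌈s⌉₊ ≤ N := Nat.ceil_le.2 hsN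
    have hc0 : 0 < ⌈s⌉₊ := Nat.ceil_pos.2 (not_le.1 hs)
    refine mul_pos (Finset.prod_pos fun i hi => h0 i ?_) (Real.rpow_pos_of_pos (h0 _ ?_) _)
    · have := Finset.mem_range.1 hi
      omega
    · omega
  · exact Real.rpow_pos_of_pos (Finset.prod_pos fun i hi => h0 i (Finset.mem_range.1 hi)) _

variable {m : ℕ} {T : Fin m → EuclideanSpace ℝ (Fin N) →L[ℝ] EuclideanSpace ℝ (Fin N)}

theorem norm_wordMap_le_one (hT : ∀ i, ‖T i‖ < 1) (u : Word m) : ‖wordMap T u‖ ≤ 1 := by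
  induction u with
  | nil => exact ContinuousLinearMap.norm_id_le
  | cons a u ih =>
    have : wordMap T (a :: u) = T a * wordMap T u := by simp [wordMap]
    rw [this]
    exact (norm_mul_le _ _).trans (mul_le_one₀ (hT a).le (norm_nonneg _) ih)

theorem wordMap_injective (hT : ∀ i, (T i).det ≠ 0) (u : Word m) :
    Function.Injective (wordMap T u) := by
  induction u with
  | nil => exact fun _ _ h => h
  | cons a u ih =>
    have : wordMap T (a :: u) = T a * wordMap T u := by simp [wordMap]
    rw [this]
    have ha : Function.Injective (T a) :=
      (LinearEquiv.ofIsUnitDet (f := (T a).toLinearMap)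
        (v := (EuclideanSpace.basisFun (Fin N) ℝ).toBasis)
        (v' := (EuclideanSpace.basisFun (Fin N) ℝ).toBasis)
        (by rw [LinearMap.det_toMatrix]; exact isUnit_iff_ne_zero.2 (hT a))).injective
    exact ha.comp ih

end SingularValues

/-! ### Joins and join sets -/

section Joins

variable {m n : ℕ}

@[simp]
theorem length_curtail (x : Code m) (k : ℕ) : (curtail x k).length = k := by simp [curtail]

theorem curtail_eq_curtail_iff {x y : Code m} {k : ℕ} :
    curtail x k = curtail y k ↔ ∀ i < k, x i = y i := by
  unfold curtail
  rw [List.ofFn_inj, funext_iff]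
  exact ⟨fun h i hi => h ⟨i, hi⟩, fun h i => h i i.2⟩

@[simp]
theorem length_join (x y : Code m) : (join x y).length = PiNat.firstDiff x y := by simp [join]

theorem join_comm (x y : Code m) : join x y = join y x := by
  rw [join, join, PiNat.firstDiff_comm y x, curtail_eq_curtail_iff]
  exact fun i hi => PiNat.apply_eq_of_lt_firstDiff hi

theorem firstDiff_eq_of_agree {x y : Code m} {k : ℕ} (h : ∀ i < k, x i = y i) (hk : x k ≠ y k) :
    PiNat.firstDiff x y = k := by
  have hxy : x ≠ y := fun e => hk (by rw [e])
  refine le_antisymm (not_lt.1 fun hlt => hk (PiNat.apply_eq_of_lt_firstDiff hlt))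
    (not_lt.1 fun hlt => PiNat.apply_firstDiff_ne hxy (h _ hlt))

/-- If `b` follows `x` beyond the point where `a` leaves `x`, then `a` leaves `b` there too. -/
theorem join_eq_of_firstDiff_lt {x a b : Code m} (hxa : x ≠ a)
    (h : PiNat.firstDiff x a < PiNat.firstDiff x b) : join b a = join x a := by
  have hxb : ∀ i ≤ PiNat.firstDiff x a, x i = b i :=
    fun i hi => PiNat.apply_eq_of_lt_firstDiff (hi.trans_lt h)
  have h1 : PiNat.firstDiff b a = PiNat.firstDiff x a := by
    refine firstDiff_eq_of_agree (fun i hi => ?_) ?_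
    · rw [← hxb i hi.le]
      exact PiNat.apply_eq_of_lt_firstDiff hi
    · rw [← hxb _ le_rfl]
      exact PiNat.apply_firstDiff_ne hxa
  rw [join, join, h1, curtail_eq_curtail_iff]
  exact fun i hi => (hxb i hi.le).symm

/-- The words of `x` with labels in `A` have all their pairwise joins equal to `v`. -/
def JoinsEq (x : Fin n → Code m) (v : Word m) (A : Finset (Fin n)) : Prop :=
  ∀ p ∈ A, ∀ q ∈ A, p ≠ q → join (x p) (x q) = v

theorem JoinsEq.card_le {x : Fin n → Code m} {v : Word m} {A : Finset (Fin n)}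
    (h : JoinsEq x v A) : A.card ≤ joinMult x v + 1 := by
  classical
  unfold joinMult
  refine le_trans (Finset.le_sup (f := Finset.card) ?_) le_tsub_add
  simp only [Finset.mem_filter, Finset.mem_univ, true_and]
  exact h

/-- Singletons qualify vacuously, so the maximal cardinality is at least 1 and the truncated
subtraction in `joinMult` loses nothing. -/
theorem exists_joinsEq_card (x : Fin (n + 1) → Code m) (v : Word m) :
    ∃ A, JoinsEq x v A ∧ A.card = joinMult x v + 1 := by
  classical
  have h0 : JoinsEq x v {0} := by
    intro p hp q hq hpq
    rw [Finset.mem_singleton] at hp hq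
    exact absurd (hp.trans hq.symm) hpq
  have hne : {0} ∈ Finset.univ.filter fun A : Finset (Fin (n + 1)) =>
      ∀ p ∈ A, ∀ q ∈ A, p ≠ q → join (x p) (x q) = v := by
    simp only [Finset.mem_filter, Finset.mem_univ, true_and]
    exact h0
  obtain ⟨A, hA, hAs⟩ := Finset.exists_mem_eq_sup _ ⟨_, hne⟩ Finset.card
  refine ⟨A, (Finset.mem_filter.1 hA).2, ?_⟩
  have h1 : 1 ≤ A.card := by
    rw [← hAs]
    exact Finset.le_sup (f := Finset.card) hne
  unfold joinMult
  have h2 : (Finset.univ.filter fun A : Finset (Fin (n + 1)) =>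
    ∀ p ∈ A, ∀ q ∈ A, p ≠ q → join (x p) (x q) = v).sup Finset.card - 1 + 1 = A.card := by
    rw [hAs]; omega
  rw [← h2]

theorem joinMult_eq {x : Fin (n + 1) → Code m} {v : Word m} {k : ℕ}
    (h : ∃ A, JoinsEq x v A ∧ k + 1 ≤ A.card) (h' : ∀ A, JoinsEq x v A → A.card ≤ k + 1) :
    joinMult x v = k := by
  obtain ⟨A, hA, hAk⟩ := h
  obtain ⟨B, hB, hBk⟩ := exists_joinsEq_card x v
  have h1 := hA.card_le
  have h2 := h' B hB
  omega

theorem joinMult_eq_zero_of_notMem {x : Fin (n + 1) → Code m} {v : Word m}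
    (hv : v ∉ joinPoints x) : joinMult x v = 0 := by
  classical
  obtain ⟨A, hA, hAc⟩ := exists_joinsEq_card x v
  by_contra h
  obtain ⟨p, hp, q, hq, hpq⟩ := Finset.one_lt_card.1 (by omega : 1 < A.card)
  refine hv ?_
  unfold joinPoints
  exact Finset.mem_image.2 ⟨(p, q), by simpa using hpq, hA p hp q hq hpq⟩

theorem JoinsEq.tail {x : Fin (n + 1) → Code m} {v : Word m} {A : Finset (Fin (n + 1))}
    (h : JoinsEq x v A) :
    JoinsEq (Fin.tail x) v (A.preimage Fin.succ (Fin.succ_injective n).injOn) := by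
  intro p hp q hq hpq
  exact h _ (Finset.mem_preimage.1 hp) _ (Finset.mem_preimage.1 hq)
    fun e => hpq (Fin.succ_injective n e)

theorem JoinsEq.of_tail {x : Fin (n + 1) → Code m} {v : Word m} {A : Finset (Fin n)}
    (h : JoinsEq (Fin.tail x) v A) : JoinsEq x v (A.map (Fin.succEmb n)) := by
  intro p hp q hq hpq
  obtain ⟨p, hp', rfl⟩ := Finset.mem_map.1 hp
  obtain ⟨q, hq', rfl⟩ := Finset.mem_map.1 hq
  exact h p hp' q hq' fun e => hpq (by rw [e])

theorem JoinsEq.insert {x : Fin n → Code m} {v : Word m} {A : Finset (Fin n)} {a : Fin n}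
    (h : JoinsEq x v A) (ha : ∀ p ∈ A, join (x a) (x p) = v) : JoinsEq x v (insert a A) := by
  intro p hp q hq hpq
  rcases Finset.mem_insert.1 hp with rfl | hp' <;> rcases Finset.mem_insert.1 hq with rfl | hq'
  · exact absurd rfl hpq
  · exact ha q hq'
  · rw [join_comm]; exact ha p hp'
  · exact h p hp' q hq' hpq

theorem card_preimage_succ_of_notMem {A : Finset (Fin (n + 1))} (h : 0 ∉ A) :
    (A.preimage Fin.succ (Fin.succ_injective n).injOn).card = A.card := by
  classical
  have : A = (A.preimage Fin.succ (Fin.succ_injective n).injOn).map (Fin.succEmb n) := by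
    ext p
    refine Fin.cases ?_ (fun p => ?_) p
    · simp [h]
    · simp
  conv_rhs => rw [this]
  rw [Finset.card_map]

theorem card_le_card_preimage_succ (A : Finset (Fin (n + 1))) :
    A.card ≤ (A.preimage Fin.succ (Fin.succ_injective n).injOn).card + 1 := by
  classical
  have h1 : (A.erase 0).card ≤ (A.preimage Fin.succ (Fin.succ_injective n).injOn).card := by
    rw [← card_preimage_succ_of_notMem (Finset.notMem_erase 0 A)]
    refine Finset.card_le_card fun p hp => ?_
    exact Finset.mem_preimage.2 (Finset.mem_of_mem_erase (Finset.mem_preimage.1 hp))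
  have := Finset.pred_card_le_card_erase (s := A) (a := 0)
  omega

/-- Adjoining a word `x 0` to the words `x 1, …, x (n + 1)` adds one point to the join set, the
longest join of `x 0` with the other words. -/
theorem joinMult_succ {x : Fin (n + 2) → Code m} (hx : Function.Injective x) {b : Fin (n + 1)}
    (hb : ∀ a : Fin (n + 1),
      PiNat.firstDiff (x 0) (x a.succ) ≤ PiNat.firstDiff (x 0) (x b.succ)) (v : Word m) :
    joinMult x v = joinMult (Fin.tail x) v + if v = join (x 0) (x b.succ) then 1 else 0 := by
  classical
  have hne : ∀ a : Fin (n + 1), x 0 ≠ x a.succ := fun a e => (Fin.succ_ne_zero a) (hx e).symm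
  obtain ⟨B, hB, hBc⟩ := exists_joinsEq_card (Fin.tail x) v
  split_ifs with hv
  · refine joinMult_eq ?_ fun A hA => ?_
    -- If `B` has two members, its words all begin with `v`, as does `x 0`; maximality of the join
    -- with `x b.succ` stops `x 0` from following any of them further, so 0 can be added to `B`.
    -- Otherwise the pair of 0 and `b.succ` is large enough.
    · by_cases h1 : 1 < B.card
      · refine ⟨_, hB.of_tail.insert (a := 0) ?_, ?_⟩
        · intro p hp
          obtain ⟨p, hp', rfl⟩ := Finset.mem_map.1 hp
          have hcurt : curtail (x p.succ) v.length = v := by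
            obtain ⟨r, hr, hrp⟩ := Finset.exists_mem_ne h1 p
            have h2 : join (x p.succ) (x r.succ) = v := hB p hp' r hr hrp.symm
            conv_rhs => rw [← h2]
            rw [join, ← h2, length_join]
          have hcurt0 : curtail (x 0) v.length = v := by
            conv_rhs => rw [hv]
            rw [join, hv, length_join]
          have hag : ∀ i < v.length, x 0 i = x p.succ i :=
            curtail_eq_curtail_iff.1 (hcurt0.trans hcurt.symm)
          have hlen : PiNat.firstDiff (x 0) (x p.succ) = v.length := by
            refine le_antisymm ?_ (not_lt.1 fun hlt =>
              PiNat.apply_firstDiff_ne (hne p) (hag _ hlt))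
            rw [hv, length_join]
            exact hb p
          change join (x 0) (x p.succ) = v
          rw [join, hlen, hcurt0]
        · rw [Finset.card_insert_of_notMem (by simp [Fin.succ_ne_zero]), Finset.card_map, hBc]
      · refine ⟨_, JoinsEq.insert (A := {b.succ}) (a := 0) ?_ ?_, ?_⟩
        · intro p hp q hq hpq
          rw [Finset.mem_singleton] at hp hq
          exact absurd (hp.trans hq.symm) hpq
        · intro p hp
          rw [Finset.mem_singleton.1 hp, hv]
        · rw [Finset.card_insert_of_notMem (by simp [(Fin.succ_ne_zero b).symm]),
            Finset.card_singleton]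
          omega
    · have h1 := hA.tail.card_le
      have h2 := card_le_card_preimage_succ A
      omega
  -- A family containing 0 and another word does not contain `b.succ`, since its members leave `x 0`
  -- strictly before `x b.succ` does. Exchanging 0 for `b.succ` then keeps all joins and the
  -- cardinality.
  · rw [add_zero]
    refine joinMult_eq ⟨_, hB.of_tail, by rw [Finset.card_map, hBc]⟩ fun A hA => ?_
    by_cases h0 : 0 ∈ A
    · by_cases h1 : ∃ a : Fin (n + 1), a.succ ∈ A
      · have hlt : ∀ a : Fin (n + 1), a.succ ∈ A →
            PiNat.firstDiff (x 0) (x a.succ) < PiNat.firstDiff (x 0) (x b.succ) := by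
          intro a ha
          refine lt_of_le_of_ne (hb a) fun e => hv ?_
          rw [← hA 0 h0 _ ha (Fin.succ_ne_zero a).symm, join, join, e]
        have hbA : b ∉ A.preimage Fin.succ (Fin.succ_injective _).injOn := fun h =>
          (hlt b (Finset.mem_preimage.1 h)).false
        have h2 : JoinsEq (Fin.tail x) v
            (insert b (A.preimage Fin.succ (Fin.succ_injective _).injOn)) := by
          refine hA.tail.insert fun p hp => ?_
          have hp' := Finset.mem_preimage.1 hp
          rw [← hA 0 h0 _ hp' (Fin.succ_ne_zero p).symm]
          exact join_eq_of_firstDiff_lt (hne p) (hlt p hp')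
        have h3 := h2.card_le
        rw [Finset.card_insert_of_notMem hbA] at h3
        have h4 := card_le_card_preimage_succ A
        omega
      · have : A ⊆ {0} := by
          intro p hp
          rcases Fin.eq_zero_or_eq_succ p with rfl | ⟨a, rfl⟩
          · simp
          · exact absurd ⟨a, hp⟩ h1
        have := Finset.card_le_card this
        rw [Finset.card_singleton] at this
        omega
    · rw [← card_preimage_succ_of_notMem h0]
      exact hA.tail.card_le

variable {N : ℕ} {T : Fin m → EuclideanSpace ℝ (Fin N) →L[ℝ] EuclideanSpace ℝ (Fin N)} {s : ℝ}

theorem multiKernel_eq_prod {x : Fin (n + 1) → Code m} (hx : Function.Injective x)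
    {S : Finset (Word m)} (hS : joinPoints x ⊆ S) :
    multiKernel T s x = ∏ v ∈ S, svf s (wordMap T v) ^ joinMult x v := by
  rw [multiKernel, if_pos hx]
  refine Finset.prod_subset hS fun v _ hv => ?_
  rw [joinMult_eq_zero_of_notMem hv, pow_zero]

theorem multiKernel_succ {x : Fin (n + 2) → Code m} (hx : Function.Injective x) {b : Fin (n + 1)}
    (hb : ∀ a : Fin (n + 1),
      PiNat.firstDiff (x 0) (x a.succ) ≤ PiNat.firstDiff (x 0) (x b.succ)) :
    multiKernel T s x =
      svf s (wordMap T (join (x 0) (x b.succ))) * multiKernel T s (Fin.tail x) := by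
  classical
  have hx' : Function.Injective (Fin.tail x) := hx.comp (Fin.succ_injective _)
  set w := join (x 0) (x b.succ) with hw
  have hS : joinPoints x ⊆ insert w (joinPoints x ∪ joinPoints (Fin.tail x)) := fun v hv =>
    Finset.mem_insert_of_mem (Finset.mem_union_left _ hv)
  have hS' : joinPoints (Fin.tail x) ⊆ insert w (joinPoints x ∪ joinPoints (Fin.tail x)) :=
    fun v hv => Finset.mem_insert_of_mem (Finset.mem_union_right _ hv)
  rw [multiKernel_eq_prod hx hS, multiKernel_eq_prod hx' hS']
  simp_rw [joinMult_succ hx hb, pow_add, Finset.prod_mul_distrib]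
  rw [mul_comm, ← hw]
  congr 1
  have : ∀ v, svf s (wordMap T v) ^ (if v = w then 1 else 0) =
      if v = w then svf s (wordMap T v) else 1 := fun v => by split_ifs <;> simp
  simp_rw [this]
  rw [Finset.prod_ite_eq' _ w, if_pos (Finset.mem_insert_self _ _)]

theorem multiKernel_one (x : Fin 1 → Code m) : multiKernel T s x = 1 := by
  have hp : joinPoints x = ∅ := by
    classical
    unfold joinPoints
    rw [Finset.image_eq_empty, Finset.filter_eq_empty_iff]
    intro p _
    simpa using Subsingleton.elim p.1 p.2
  rw [multiKernel, if_pos (Function.injective_of_subsingleton x), hp, Finset.prod_empty]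

end Joins

/-! ### The kernel summed along common initial words -/

section PathKernel

variable {m n : ℕ}

theorem measurable_comp_curtail {β : Type*} [MeasurableSpace β] (f : Word m → β) (k : ℕ) :
    Measurable fun x : Code m => f (curtail x k) := by
  have h1 : Measurable fun (x : Code m) (i : Fin k) => x i :=
    measurable_pi_lambda _ fun i => measurable_pi_apply _
  exact (Measurable.of_discrete (f := fun u : Fin k → Fin m => f (List.ofFn u))).comp h1

theorem measurable_comp_curtail₂ {β : Type*} [MeasurableSpace β] (f : Word m → Word m → β)
    (k : ℕ) : Measurable fun x : Code m × Code m => f (curtail x.1 k) (curtail x.2 k) := by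
  have h1 : Measurable fun (x : Code m) (i : Fin k) => x i :=
    measurable_pi_lambda _ fun i => measurable_pi_apply _
  exact (Measurable.of_discrete
    (f := fun u : (Fin k → Fin m) × (Fin k → Fin m) => f (List.ofFn u.1) (List.ofFn u.2))).comp
    ((h1.comp measurable_fst).prodMk (h1.comp measurable_snd))

theorem mem_cyl_curtail {x y : Code m} {k : ℕ} :
    y ∈ cyl (curtail x k) ↔ curtail y k = curtail x k := by
  simp [cyl]

theorem measurableSet_cyl (u : Word m) : MeasurableSet (cyl u) :=
  measurableSet_setOfPred.2 (measurable_comp_curtail (fun v => v = u) u.length)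

/-- The sum of `h u` over the common finite initial words `u` of `x` and `y`. -/
def pathKernel (h : Word m → ℝ≥0∞) (x y : Code m) : ℝ≥0∞ :=
  ∑' k, if curtail x k = curtail y k then h (curtail x k) else 0

variable {h : Word m → ℝ≥0∞}

theorem measurable_pathKernel (h : Word m → ℝ≥0∞) :
    Measurable fun z : Code m × Code m => pathKernel h z.1 z.2 :=
  Measurable.tsum fun k =>
    measurable_comp_curtail₂ (fun u v => if u = v then h u else 0) k

theorem apply_curtail_le_pathKernel {x y : Code m} {k : ℕ} (hk : curtail x k = curtail y k) :
    h (curtail x k) ≤ pathKernel h x y := by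
  refine le_trans (le_of_eq ?_) (ENNReal.le_tsum k)
  rw [if_pos hk]

theorem apply_join_le_pathKernel (x y : Code m) : h (join x y) ≤ pathKernel h x y :=
  apply_curtail_le_pathKernel
    (curtail_eq_curtail_iff.2 fun _ hi => PiNat.apply_eq_of_lt_firstDiff hi)

theorem one_le_pathKernel (hh : ∀ u, 1 ≤ h u) (x y : Code m) : 1 ≤ pathKernel h x y :=
  (hh _).trans (apply_join_le_pathKernel x y)

/-- Makes the tree bound infinite when words coincide, matching the convention for the kernel. -/
theorem pathKernel_self (hh : ∀ u, 1 ≤ h u) (x : Code m) : pathKernel h x x = ⊤ := by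
  refine top_unique ?_
  calc (⊤ : ℝ≥0∞) = ∑' _ : ℕ, 1 := (ENNReal.tsum_const_eq_top_of_ne_zero one_ne_zero).symm
    _ ≤ pathKernel h x x := ENNReal.tsum_le_tsum fun k => by simpa using hh _

/-- The product over the labels `a < n` of the sums over `b > a` of the kernels of `x a` and
`x b`. -/
def treeWeight (h : Word m → ℝ≥0∞) : (n : ℕ) → (Fin (n + 1) → Code m) → ℝ≥0∞
  | 0, _ => 1
  | n + 1, x => (∑ b : Fin (n + 1), pathKernel h (x 0) (x b.succ)) * treeWeight h n (Fin.tail x)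

theorem measurable_treeWeight (h : Word m → ℝ≥0∞) (n : ℕ) : Measurable (treeWeight h n) := by
  induction n with
  | zero => exact measurable_const
  | succ n ih =>
    refine Measurable.mul (Finset.measurable_sum _ fun b _ => ?_) (ih.comp ?_)
    · have hpair : Measurable fun x : Fin (n + 2) → Code m => (x 0, x b.succ) :=
        (measurable_pi_apply 0).prodMk (measurable_pi_apply b.succ)
      exact (measurable_pathKernel h).comp hpair
    · exact measurable_pi_lambda _ fun i => measurable_pi_apply _

/-- Keeps an infinite factor from being cancelled by a zero one, as ∞ · 0 = 0 in `ℝ≥0∞`. -/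
theorem one_le_treeWeight (hh : ∀ u, 1 ≤ h u) (x : Fin (n + 1) → Code m) :
    1 ≤ treeWeight h n x := by
  induction n with
  | zero => exact le_rfl
  | succ n ih =>
    refine one_le_mul ?_ (ih _)
    exact (one_le_pathKernel hh (x 0) (x (Fin.succ 0))).trans
      (Finset.single_le_sum (f := fun b : Fin (n + 1) => pathKernel h (x 0) (x b.succ))
        (fun _ _ => zero_le) (Finset.mem_univ 0))

variable {N : ℕ} {T : Fin m → EuclideanSpace ℝ (Fin N) →L[ℝ] EuclideanSpace ℝ (Fin N)} {s : ℝ}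

/-- The reciprocal `φ^s(T_u)⁻¹` in `[0, ∞]`. -/
def invSvf (T : Fin m → EuclideanSpace ℝ (Fin N) →L[ℝ] EuclideanSpace ℝ (Fin N)) (s : ℝ)
    (u : Word m) : ℝ≥0∞ :=
  (ENNReal.ofReal (svf s (wordMap T u)))⁻¹

theorem one_le_invSvf (hT : ∀ i, ‖T i‖ < 1) (u : Word m) : 1 ≤ invSvf T s u := by
  rw [invSvf, ENNReal.one_le_inv]
  exact ENNReal.ofReal_le_one.2 (svf_le_one (norm_wordMap_le_one hT u))

/-- The new join point is the join with the word nearest to `x 0`. Which word this is depends on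
`x`, so one sums over all candidates. -/
theorem inv_multiKernel_le_treeWeight (hT : ∀ i, ‖T i‖ < 1) (hT' : ∀ i, (T i).det ≠ 0)
    (x : Fin (n + 1) → Code m) :
    (ENNReal.ofReal (multiKernel T s x))⁻¹ ≤ treeWeight (invSvf T s) n x := by
  have hh := one_le_invSvf (s := s) hT
  induction n with
  | zero => simp [multiKernel_one, treeWeight]
  | succ n ih =>
    rw [treeWeight]
    have hle : ∀ b : Fin (n + 1), pathKernel (invSvf T s) (x 0) (x b.succ) ≤
        ∑ b : Fin (n + 1), pathKernel (invSvf T s) (x 0) (x b.succ) := fun b =>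
      Finset.single_le_sum
        (f := fun b : Fin (n + 1) => pathKernel (invSvf T s) (x 0) (x b.succ))
        (fun _ _ => zero_le) (Finset.mem_univ b)
    by_cases hx : Function.Injective x
    · obtain ⟨b, hb⟩ := Finite.exists_max
        fun a : Fin (n + 1) => PiNat.firstDiff (x 0) (x a.succ)
      rw [multiKernel_succ hx hb,
        ENNReal.ofReal_mul (svf_pos s (wordMap_injective hT' _)).le, ENNReal.mul_inv
          (Or.inl (ENNReal.ofReal_pos.2 (svf_pos s (wordMap_injective hT' _))).ne')
          (Or.inl ENNReal.ofReal_ne_top)]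
      exact mul_le_mul' ((apply_join_le_pathKernel (h := invSvf T s) _ _).trans (hle b)) (ih _)
    · refine le_top.trans (ge_of_eq ?_)
      by_cases hx' : Function.Injective (Fin.tail x)
      · have : ∃ b : Fin (n + 1), x b.succ = x 0 := by
          by_contra hcon
          refine hx ?_
          rw [← Fin.cons_self_tail x, Fin.cons_injective_iff]
          exact ⟨fun ⟨b, hb⟩ => hcon ⟨b, hb⟩, hx'⟩
        obtain ⟨b, hb⟩ := this
        have h1 := hle b
        rw [hb, pathKernel_self hh] at h1
        rw [top_unique h1, ENNReal.top_mul]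
        exact (one_pos.trans_le (one_le_treeWeight hh _)).ne'
      · have h1 := ih (Fin.tail x)
        rw [multiKernel, if_neg hx', ENNReal.ofReal_zero, ENNReal.inv_zero] at h1
        rw [top_unique h1, ENNReal.mul_top]
        exact (one_pos.trans_le ((one_le_pathKernel hh _ _).trans (hle 0))).ne'

end PathKernel

/-! ### Potentials -/

section Potential

variable {m : ℕ} {h : Word m → ℝ≥0∞} {μ : Measure (Code m)}

theorem lintegral_comp_curtail (μ : Measure (Code m)) (f : Word m → ℝ≥0∞) (k : ℕ) :
    ∫⁻ x, f (curtail x k) ∂μ =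
      ∑ u : Fin k → Fin m, f (List.ofFn u) * μ (cyl (List.ofFn u)) := by
  have h1 : Measurable fun (x : Code m) (i : Fin k) => x i :=
    measurable_pi_lambda _ fun i => measurable_pi_apply _
  have h2 := lintegral_map (μ := μ)
    (Measurable.of_discrete (f := fun u : Fin k → Fin m => f (List.ofFn u))) h1
  refine h2.symm.trans ?_
  rw [lintegral_fintype]
  refine Finset.sum_congr rfl fun u _ => ?_
  rw [Measure.map_apply h1 (measurableSet_singleton u)]
  congr 2
  ext x
  simp only [Set.mem_preimage, Set.mem_singleton_iff, cyl, Set.mem_ofPred_eq, curtail]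
  constructor
  · rintro rfl
    simp
  · intro hx
    rw [List.ofFn_congr (List.length_ofFn (f := u))] at hx
    exact List.ofFn_injective hx

/-- On each cylinder, mass times average is at most the integral of `H`, and the cylinders of length
`k` partition the code space. -/
theorem lintegral_setLAverage_curtail_le (μ : Measure (Code m)) (H : Code m → ℝ≥0∞) (k : ℕ) :
    ∫⁻ x, (∫⁻ y in cyl (curtail x k), H y ∂μ) / μ (cyl (curtail x k)) ∂μ ≤ ∫⁻ y, H y ∂μ := by
  rw [lintegral_comp_curtail μ (fun u => (∫⁻ y in cyl u, H y ∂μ) / μ (cyl u)) k]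
  have h1 := lintegral_comp_curtail (μ.withDensity H) (fun _ => 1) k
  rw [lintegral_one, withDensity_apply _ MeasurableSet.univ, Measure.restrict_univ] at h1
  rw [h1]
  refine Finset.sum_le_sum fun u _ => ?_
  rw [one_mul, withDensity_apply _ (measurableSet_cyl _), mul_comm]
  exact ENNReal.mul_div_le

/-- The potential of the density `F` with respect to the kernel `pathKernel h`. -/
def potential (h : Word m → ℝ≥0∞) (μ : Measure (Code m)) (F : Code m → ℝ≥0∞) (x : Code m) :
    ℝ≥0∞ :=
  ∫⁻ y, F y * pathKernel h y x ∂μ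

theorem potential_eq_tsum {F : Code m → ℝ≥0∞} (hF : Measurable F) (x : Code m) :
    potential h μ F x =
      ∑' k, h (curtail x k) * ∫⁻ y in cyl (curtail x k), F y ∂μ := by
  unfold potential pathKernel
  simp_rw [← ENNReal.tsum_mul_left]
  rw [lintegral_tsum fun k => (Measurable.fun_mul hF (measurable_comp_curtail
    (fun u => if u = curtail x k then h u else 0) k)).aemeasurable]
  refine tsum_congr fun k => ?_
  rw [← lintegral_const_mul _ hF, ← lintegral_indicator (measurableSet_cyl _)]
  refine lintegral_congr fun y => ?_
  by_cases hy : curtail y k = curtail x k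
  · rw [if_pos hy, Set.indicator_of_mem (mem_cyl_curtail.2 hy), hy, mul_comm]
  · rw [if_neg hy, Set.indicator_of_notMem (fun h => hy (mem_cyl_curtail.1 h)), mul_zero]

theorem measurable_potential {F : Code m → ℝ≥0∞} (hF : Measurable F) :
    Measurable (potential h μ F) := by
  rw [funext (potential_eq_tsum hF)]
  exact Measurable.tsum fun k =>
    measurable_comp_curtail (fun u => h u * ∫⁻ y in cyl u, F y ∂μ) k

/-- Jensen for the concave power `θ`, obtained from Hölder against the constant 1. -/
theorem setLIntegral_rpow_le {α : Type*} [MeasurableSpace α] (μ : Measure α) [IsFiniteMeasure μ]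
    {H : α → ℝ≥0∞} (hH : Measurable H) (A : Set α) {θ : ℝ} (h0 : 0 ≤ θ) (h1 : θ ≤ 1) :
    ∫⁻ y in A, H y ^ θ ∂μ ≤ μ A * ((∫⁻ y in A, H y ∂μ) / μ A) ^ θ := by
  by_cases hA : μ A = 0
  · rw [Measure.restrict_eq_zero.2 hA]
    simp
  have hA' : μ A ≠ ⊤ := measure_ne_top μ A
  have h2 := ENNReal.lintegral_mul_norm_pow_le (μ := μ.restrict A) hH.aemeasurable
    (measurable_const (a := (1 : ℝ≥0∞))).aemeasurable h0 (sub_nonneg.2 h1) (by ring)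
  simp only [ENNReal.one_rpow, mul_one, lintegral_one, Measure.restrict_apply_univ] at h2
  refine h2.trans (le_of_eq ?_)
  rw [ENNReal.div_rpow_of_nonneg _ _ h0, ENNReal.rpow_sub _ _ hA hA', ENNReal.rpow_one,
    div_eq_mul_inv, div_eq_mul_inv]
  ring

/-- `F` is measurable and bounded by a multiple of `H ^ (e / p)` for some integrable `H`; for
`e > 0` this says that `F` is in `L^(p/e)`, and for `e = 0` that `F` is bounded. -/
def WeightBound (μ : Measure (Code m)) (p : ℝ) (e : ℕ) (F : Code m → ℝ≥0∞) : Prop :=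
  Measurable F ∧ ∃ C : ℝ≥0∞, C ≠ ⊤ ∧ ∃ H : Code m → ℝ≥0∞, Measurable H ∧ ∫⁻ x, H x ∂μ ≠ ⊤ ∧
    ∀ x, F x ≤ C * H x ^ ((e : ℝ) / p)

namespace WeightBound

variable {p : ℝ} {e f : ℕ} {F G : Code m → ℝ≥0∞}

theorem one (μ : Measure (Code m)) (p : ℝ) : WeightBound μ p 0 fun _ => 1 :=
  ⟨measurable_const, 1, ENNReal.one_ne_top, 0, measurable_zero, by simp, by simp⟩

theorem zero (μ : Measure (Code m)) (p : ℝ) (e : ℕ) : WeightBound μ p e fun _ => 0 :=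
  ⟨measurable_const, 0, ENNReal.zero_ne_top, 0, measurable_zero, by simp, by simp⟩

/-- The common majorant `H + J` lets the exponents add pointwise; this also covers p/e < 1, where
L^(p/e) is not normed. -/
theorem mul (hp : 0 < p) (hF : WeightBound μ p e F) (hG : WeightBound μ p f G) :
    WeightBound μ p (e + f) fun x => F x * G x := by
  obtain ⟨hFm, C, hC, H, hH, hHi, hFH⟩ := hF
  obtain ⟨hGm, D, hD, J, hJ, hJi, hGJ⟩ := hG
  refine ⟨hFm.mul hGm, C * D, ENNReal.mul_ne_top hC hD, fun x => H x + J x, hH.add hJ, ?_,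
    fun x => ?_⟩
  · rw [lintegral_add_left hH]
    exact ENNReal.add_ne_top.2 ⟨hHi, hJi⟩
  · calc F x * G x ≤ C * H x ^ ((e : ℝ) / p) * (D * J x ^ ((f : ℝ) / p)) :=
        mul_le_mul' (hFH x) (hGJ x)
      _ ≤ C * (H x + J x) ^ ((e : ℝ) / p) * (D * (H x + J x) ^ ((f : ℝ) / p)) := by
        gcongr
        · exact le_self_add
        · exact le_add_self
      _ = C * D * (H x + J x) ^ (((e + f : ℕ) : ℝ) / p) := by
        rw [Nat.cast_add, add_div,
          ENNReal.rpow_add_of_nonneg _ _ (by positivity) (by positivity)]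
        ring

theorem add (hp : 0 < p) (hF : WeightBound μ p e F) (hG : WeightBound μ p e G) :
    WeightBound μ p e fun x => F x + G x := by
  obtain ⟨hFm, C, hC, H, hH, hHi, hFH⟩ := hF
  obtain ⟨hGm, D, hD, J, hJ, hJi, hGJ⟩ := hG
  refine ⟨hFm.add hGm, C + D, ENNReal.add_ne_top.2 ⟨hC, hD⟩, fun x => H x + J x, hH.add hJ, ?_,
    fun x => ?_⟩
  · rw [lintegral_add_left hH]
    exact ENNReal.add_ne_top.2 ⟨hHi, hJi⟩
  · rw [add_mul]
    refine add_le_add ((hFH x).trans ?_) ((hGJ x).trans ?_)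
    · gcongr
      exact le_self_add
    · gcongr
      exact le_add_self

theorem sum (hp : 0 < p) {ι : Type*} (S : Finset ι) {F : ι → Code m → ℝ≥0∞}
    (hF : ∀ i ∈ S, WeightBound μ p e (F i)) : WeightBound μ p e fun x => ∑ i ∈ S, F i x := by
  classical
  induction S using Finset.induction_on with
  | empty => simpa using zero μ p e
  | insert a S ha ih =>
    simp_rw [Finset.sum_insert ha]
    exact (hF a (Finset.mem_insert_self _ _)).add hp
      (ih fun i hi => hF i (Finset.mem_insert_of_mem hi))

theorem potential [IsFiniteMeasure μ] (hp : 0 < p) (hep : (e : ℝ) ≤ p) {c : ℝ≥0∞} (hc : c ≠ ⊤)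
    {r : ℝ} (hr : 0 < r) (hr1 : r < 1)
    (hdecay : ∀ k, ∫⁻ x, (h (curtail x k) * μ (cyl (curtail x k))) ^ p ∂μ ≤
      c * ENNReal.ofReal r ^ k)
    (hF : WeightBound μ p e F) : WeightBound μ p (e + 1) (potential h μ F) := by
  obtain ⟨hFm, C, hC, H, hH, hHi, hFH⟩ := hF
  -- Half of the decay, σ^(e+1) per level, makes `M₁` integrable. The other half bounds a_k^p by
  -- `M₁`; of it, σ^e pays for the e factors `E k` bounded through `M₂`, and the remaining σ makes
  -- the sum over levels converge.
  obtain ⟨σ, hσ0, hσ1, hσr⟩ : ∃ σ : ℝ≥0∞, σ ≠ 0 ∧ σ < 1 ∧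
      ENNReal.ofReal r = σ ^ (e + 1) * σ ^ (e + 1) := by
    have he : (0 : ℝ) < ((e + 1) + (e + 1) : ℕ) := by positivity
    refine ⟨ENNReal.ofReal r ^ (((e + 1) + (e + 1) : ℕ) : ℝ)⁻¹, ?_, ?_, ?_⟩
    · exact (ENNReal.rpow_pos (ENNReal.ofReal_pos.2 hr) ENNReal.ofReal_ne_top).ne'
    · exact ENNReal.rpow_lt_one (ENNReal.ofReal_lt_one.2 hr1) (inv_pos.2 he)
    · rw [← pow_add, ← ENNReal.rpow_natCast, ← ENNReal.rpow_mul, inv_mul_cancel₀ he.ne',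
        ENNReal.rpow_one]
  have hσt : σ ≠ ⊤ := hσ1.ne_top
  set a : ℕ → Code m → ℝ≥0∞ := fun k x => h (curtail x k) * μ (cyl (curtail x k)) with ha
  set E : ℕ → Code m → ℝ≥0∞ :=
    fun k x => (∫⁻ y in cyl (curtail x k), H y ∂μ) / μ (cyl (curtail x k)) with hE
  have ham : ∀ k, Measurable (a k) := fun k =>
    measurable_comp_curtail (fun u => h u * μ (cyl u)) k
  have hEm : ∀ k, Measurable (E k) := fun k =>
    measurable_comp_curtail (fun u => (∫⁻ y in cyl u, H y ∂μ) / μ (cyl u)) k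
  set M₁ : Code m → ℝ≥0∞ := fun x => ∑' k, ((σ ^ (e + 1)) ^ k)⁻¹ * a k x ^ p with hM₁
  set M₂ : Code m → ℝ≥0∞ := fun x => ∑' k, σ ^ k * E k x with hM₂
  have hM₁m : Measurable M₁ :=
    Measurable.tsum fun k => ((ham k).pow_const p).const_mul _
  have hM₂m : Measurable M₂ := Measurable.tsum fun k => (hEm k).const_mul _
  have hgeo : ∀ t : ℝ≥0∞, t < 1 → ∑' k, t ^ k ≠ ⊤ := fun t ht => by
    rw [ENNReal.tsum_geometric]
    exact ENNReal.inv_ne_top.2 (tsub_pos_of_lt ht).ne'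
  have hpow0 : ∀ k, (σ ^ (e + 1)) ^ k ≠ 0 := fun k => pow_ne_zero _ (pow_ne_zero _ hσ0)
  have hpowt : ∀ k, (σ ^ (e + 1)) ^ k ≠ ⊤ := fun k =>
    ENNReal.pow_ne_top (ENNReal.pow_ne_top hσt)
  have hM₁i : ∫⁻ x, M₁ x ∂μ ≠ ⊤ := by
    rw [hM₁, lintegral_tsum fun k => (((ham k).pow_const p).const_mul _).aemeasurable]
    refine ne_top_of_le_ne_top (ENNReal.mul_ne_top hc (hgeo (σ ^ (e + 1)) ?_)) ?_
    · exact pow_lt_one₀ zero_le hσ1 (Nat.succ_ne_zero e)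
    rw [← ENNReal.tsum_mul_left]
    refine ENNReal.tsum_le_tsum fun k => ?_
    rw [lintegral_const_mul _ ((ham k).pow_const p)]
    calc ((σ ^ (e + 1)) ^ k)⁻¹ * ∫⁻ x, a k x ^ p ∂μ
        ≤ ((σ ^ (e + 1)) ^ k)⁻¹ * (c * ENNReal.ofReal r ^ k) := by gcongr; exact hdecay k
      _ = c * (σ ^ (e + 1)) ^ k * (((σ ^ (e + 1)) ^ k)⁻¹ * (σ ^ (e + 1)) ^ k) := by
        rw [hσr, mul_pow]; ring
      _ = c * (σ ^ (e + 1)) ^ k := by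
        rw [ENNReal.inv_mul_cancel (hpow0 k) (hpowt k), mul_one]
  have hM₂i : ∫⁻ x, M₂ x ∂μ ≠ ⊤ := by
    rw [hM₂, lintegral_tsum fun k => ((hEm k).const_mul _).aemeasurable]
    refine ne_top_of_le_ne_top (ENNReal.mul_ne_top (hgeo σ hσ1) hHi) ?_
    rw [← ENNReal.tsum_mul_right]
    refine ENNReal.tsum_le_tsum fun k => ?_
    rw [lintegral_const_mul _ (hEm k)]
    exact mul_le_mul_right (lintegral_setLAverage_curtail_le μ H k) _
  have hterm : ∀ k x, a k x * E k x ^ ((e : ℝ) / p) ≤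
      (σ ^ p⁻¹) ^ k * (M₁ x + M₂ x) ^ (((e + 1 : ℕ) : ℝ) / p) := by
    intro k x
    have h1 : a k x ^ p ≤ (σ ^ (e + 1)) ^ k * M₁ x := by
      calc a k x ^ p = (σ ^ (e + 1)) ^ k * (((σ ^ (e + 1)) ^ k)⁻¹ * a k x ^ p) := by
            rw [← mul_assoc, ENNReal.mul_inv_cancel (hpow0 k) (hpowt k), one_mul]
        _ ≤ _ := by
          gcongr
          exact ENNReal.le_tsum (f := fun k => ((σ ^ (e + 1)) ^ k)⁻¹ * a k x ^ p) k
    have h2 : σ ^ k * E k x ≤ M₂ x := ENNReal.le_tsum (f := fun k => σ ^ k * E k x) k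
    have hpi : 0 ≤ p⁻¹ := (inv_pos.2 hp).le
    calc a k x * E k x ^ ((e : ℝ) / p) = (a k x ^ p * E k x ^ e) ^ p⁻¹ := by
          rw [ENNReal.mul_rpow_of_nonneg _ _ hpi, ← ENNReal.rpow_mul, mul_inv_cancel₀ hp.ne',
            ENNReal.rpow_one, ← ENNReal.rpow_natCast, ← ENNReal.rpow_mul, div_eq_mul_inv]
      _ ≤ ((σ ^ (e + 1)) ^ k * M₁ x * E k x ^ e) ^ p⁻¹ := by gcongr
      _ = (σ ^ k * (M₁ x * (σ ^ k * E k x) ^ e)) ^ p⁻¹ := by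
          congr 1
          ring
      _ ≤ (σ ^ k * ((M₁ x + M₂ x) * (M₁ x + M₂ x) ^ e)) ^ p⁻¹ := by
          gcongr
          · exact le_self_add
          · exact h2.trans le_add_self
      _ = (σ ^ p⁻¹) ^ k * (M₁ x + M₂ x) ^ (((e + 1 : ℕ) : ℝ) / p) := by
          rw [← pow_succ', ENNReal.mul_rpow_of_nonneg _ _ hpi, div_eq_mul_inv, ENNReal.rpow_mul,
            ENNReal.rpow_natCast]
          congr 1
          rw [← ENNReal.rpow_natCast, ← ENNReal.rpow_natCast, ← ENNReal.rpow_mul,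
            ← ENNReal.rpow_mul, mul_comm]
  refine ⟨measurable_potential hFm, C * ∑' k, (σ ^ p⁻¹) ^ k,
    ENNReal.mul_ne_top hC (hgeo _ (ENNReal.rpow_lt_one hσ1 (inv_pos.2 hp))),
    fun x => M₁ x + M₂ x, hM₁m.add hM₂m, ?_, fun x => ?_⟩
  · rw [lintegral_add_left hM₁m]
    exact ENNReal.add_ne_top.2 ⟨hM₁i, hM₂i⟩
  rw [potential_eq_tsum hFm, mul_assoc, ← ENNReal.tsum_mul_right, ← ENNReal.tsum_mul_left]
  refine ENNReal.tsum_le_tsum fun k => ?_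
  calc h (curtail x k) * ∫⁻ y in cyl (curtail x k), F y ∂μ
      ≤ h (curtail x k) * ∫⁻ y in cyl (curtail x k), C * H y ^ ((e : ℝ) / p) ∂μ := by
        gcongr with y
        exact hFH y
    _ = h (curtail x k) * (C * ∫⁻ y in cyl (curtail x k), H y ^ ((e : ℝ) / p) ∂μ) := by
        rw [lintegral_const_mul _ (hH.pow_const _)]
    _ ≤ h (curtail x k) * (C * (μ (cyl (curtail x k)) * E k x ^ ((e : ℝ) / p))) := by
        gcongr
        -- Jensen enters here, with exponent e/p ≤ 1.
        exact setLIntegral_rpow_le μ hH _ (by positivity) ((div_le_one hp).2 hep)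
    _ = C * (a k x * E k x ^ ((e : ℝ) / p)) := by
        rw [ha]; ring
    _ ≤ _ := mul_le_mul_right (hterm k x) _

end WeightBound

end Potential

/-! ### Integration over trees -/

section TreeIntegral

/-- The first coordinate is innermost because the first word is always a leaf of the tree. -/
theorem lintegral_pi_succ {α : Type*} [MeasurableSpace α] (μ : Measure α) [SigmaFinite μ] {n : ℕ}
    {f : (Fin (n + 1) → α) → ℝ≥0∞} (hf : Measurable f) :
    ∫⁻ i, f i ∂(Measure.pi fun _ => μ) =
      ∫⁻ i : Fin n → α, ∫⁻ y, f (Fin.cons y i) ∂μ ∂(Measure.pi fun _ => μ) := by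
  have h1 := (measurePreserving_piFinSuccAbove (fun _ : Fin (n + 1) => μ) 0).symm
  rw [← h1.lintegral_comp hf, lintegral_prod_symm
    (fun z => f ((MeasurableEquiv.piFinSuccAbove (fun _ => α) 0).symm z))
    (hf.comp h1.measurable).aemeasurable]
  simp [MeasurableEquiv.piFinSuccAbove, Fin.insertNthEquiv]

variable {m : ℕ} {h : Word m → ℝ≥0∞} {μ : Measure (Code m)} {p : ℝ}

theorem measurable_prod_mul_treeWeight {n : ℕ} {F : Fin (n + 1) → Code m → ℝ≥0∞}
    (hF : ∀ a, Measurable (F a)) :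
    Measurable fun x : Fin (n + 1) → Code m => (∏ a, F a (x a)) * treeWeight h n x :=
  Measurable.fun_mul (Finset.measurable_fun_prod _ fun a _ => (hF a).comp (measurable_pi_apply a))
    (measurable_treeWeight h n)

theorem measurable_snoc {α : Type*} [MeasurableSpace α] {n : ℕ} (j : α) :
    Measurable fun i : Fin n → α => (Fin.snoc (α := fun _ => α) i j : Fin (n + 1) → α) := by
  refine measurable_pi_lambda _ fun a => ?_
  refine Fin.lastCases ?_ (fun b => ?_) a
  · simp
  · simpa using measurable_pi_apply b

/-- Integrating out the first word turns the factors at the other words into products with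
potentials. -/
theorem lintegral_cons_prod_mul_treeWeight {n : ℕ} {F : Fin (n + 2) → Code m → ℝ≥0∞}
    (hF : ∀ a, Measurable (F a)) (x : Fin (n + 1) → Code m) :
    ∫⁻ y, (∏ a, F a ((Fin.cons y x : Fin (n + 2) → Code m) a)) *
        treeWeight h (n + 1) (Fin.cons y x : Fin (n + 2) → Code m) ∂μ =
      ∑ b : Fin (n + 1), (∏ a : Fin (n + 1),
        F a.succ (x a) * (if a = b then potential h μ (F 0) (x a) else 1)) * treeWeight h n x := by
  have h1 : ∀ b : Fin (n + 1), Measurable fun y => F 0 y * pathKernel h y (x b) := fun b =>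
    (hF 0).mul ((measurable_pathKernel h).comp (measurable_id.prodMk measurable_const))
  have h2 : ∀ y, (∏ a, F a ((Fin.cons y x : Fin (n + 2) → Code m) a)) *
        treeWeight h (n + 1) (Fin.cons y x : Fin (n + 2) → Code m) =
      (∑ b : Fin (n + 1), F 0 y * pathKernel h y (x b)) *
        ((∏ a : Fin (n + 1), F a.succ (x a)) * treeWeight h n x) := by
    intro y
    rw [Fin.prod_univ_succ, treeWeight, ← Finset.mul_sum]
    simp only [Fin.cons_zero, Fin.cons_succ, Fin.tail_cons]
    ring
  simp_rw [h2]
  rw [lintegral_mul_const _ (Finset.measurable_fun_sum _ fun b _ => h1 b),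
    lintegral_finsetSum _ fun b _ => h1 b, Finset.sum_mul]
  refine Finset.sum_congr rfl fun b _ => ?_
  rw [Finset.prod_mul_distrib, Finset.prod_ite_eq' Finset.univ b, if_pos (Finset.mem_univ b),
    potential]
  ring

/-- Arbitrary weights at the vertices make the induction close: removing the first word changes the
weight at its parent only. Edges plus degrees is the invariant, since the lost edge reappears as the
extra degree of the potential. -/
theorem WeightBound.lintegral_treeWeight [IsFiniteMeasure μ] (hp : 0 < p) {c : ℝ≥0∞} (hc : c ≠ ⊤)
    {r : ℝ} (hr : 0 < r) (hr1 : r < 1)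
    (hdecay : ∀ k, ∫⁻ x, (h (curtail x k) * μ (cyl (curtail x k))) ^ p ∂μ ≤
      c * ENNReal.ofReal r ^ k)
    {n : ℕ} {F : Fin (n + 1) → Code m → ℝ≥0∞} {e : Fin (n + 1) → ℕ}
    (hF : ∀ a, WeightBound μ p (e a) (F a)) (he : ((n + ∑ a, e a : ℕ) : ℝ) ≤ p + 1) :
    WeightBound μ p (n + ∑ a, e a) fun j => ∫⁻ i : Fin n → Code m,
      (∏ a, F a ((Fin.snoc (α := fun _ => Code m) i j : Fin (n + 1) → Code m) a)) *
        treeWeight h n (Fin.snoc (α := fun _ => Code m) i j) ∂(Measure.pi fun _ => μ) := by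
  induction n with
  | zero => simpa [treeWeight, Fin.snoc] using hF 0
  | succ n ih =>
    have hpot : WeightBound μ p (e 0 + 1) (AlmostSelfAffine.potential h μ (F 0)) := by
      refine WeightBound.potential hp ?_ hc hr hr1 hdecay (hF 0)
      -- At least one edge remains, which turns the bound p + 1 on the total into e 0 ≤ p, as Jensen
      -- needs.
      have h1 : e 0 + 1 ≤ n + 1 + ∑ a, e a := by
        rw [Fin.sum_univ_succ]
        omega
      have h2 : ((e 0 + 1 : ℕ) : ℝ) ≤ p + 1 := (Nat.cast_le.2 h1).trans he
      push_cast at h2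
      linarith
    have hF' : ∀ b a : Fin (n + 1), WeightBound μ p (e a.succ + if a = b then e 0 + 1 else 0)
        fun x => F a.succ x *
          (if a = b then AlmostSelfAffine.potential h μ (F 0) x else 1) := by
      intro b a
      by_cases hab : a = b
      · simpa only [if_pos hab] using (hF a.succ).mul hp hpot
      · simpa only [if_neg hab] using (hF a.succ).mul hp (WeightBound.one μ p)
    have he' : ∀ b : Fin (n + 1), n + ∑ a : Fin (n + 1), (e a.succ + if a = b then e 0 + 1 else 0) =
        n + 1 + ∑ a, e a := by
      intro b
      rw [Finset.sum_add_distrib, Finset.sum_ite_eq' Finset.univ b, if_pos (Finset.mem_univ b),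
        Fin.sum_univ_succ (f := e)]
      ring
    have hsum := WeightBound.sum hp Finset.univ fun b _ =>
      (he' b) ▸ ih (hF' b) (by rw [he' b]; exact he)
    refine (congrArg (WeightBound μ p _) (funext fun j => ?_)).mp hsum
    have hpi := lintegral_pi_succ μ
      (f := fun i : Fin (n + 1) → Code m =>
        (∏ a, F a ((Fin.snoc (α := fun _ => Code m) i j : Fin (n + 2) → Code m) a)) *
          treeWeight h (n + 1) (Fin.snoc (α := fun _ => Code m) i j))
      ((measurable_prod_mul_treeWeight fun a => (hF a).1).comp (measurable_snoc j))
    refine Eq.trans (lintegral_finsetSum _ fun b _ =>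
      (measurable_prod_mul_treeWeight fun a => (hF' b a).1).comp (measurable_snoc j)).symm
      (Eq.trans (lintegral_congr fun i => ?_) hpi.symm)
    simp only [← Fin.cons_snoc_eq_snoc_cons]
    exact (lintegral_cons_prod_mul_treeWeight (fun a => (hF a).1) _).symm

end TreeIntegral

/-! ### Moment sums -/

section MomentSum

variable {N m : ℕ} {T : Fin m → EuclideanSpace ℝ (Fin N) →L[ℝ] EuclideanSpace ℝ (Fin N)}

/-- Integrating over a cylinder supplies one more factor of its mass, raising the exponent of μ from
q - 1 to q. -/
theorem lintegral_invSvf_mul_measure_rpow (hT : ∀ i, (T i).det ≠ 0) (μ : Measure (Code m))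
    [IsFiniteMeasure μ] {q : ℝ} (hq : 1 < q) (s : ℝ) (k : ℕ) :
    ∫⁻ x, (invSvf T s (curtail x k) * μ (cyl (curtail x k))) ^ (q - 1) ∂μ =
      ENNReal.ofReal (momentSum T μ s q k) := by
  have hpos : ∀ u, 0 < svf s (wordMap T u) := fun u => svf_pos s (wordMap_injective hT u)
  rw [lintegral_comp_curtail μ (fun u => (invSvf T s u * μ (cyl u)) ^ (q - 1)), momentSum,
    ENNReal.ofReal_sum_of_nonneg fun u _ => mul_nonneg (Real.rpow_nonneg (hpos _).le _)
      (Real.rpow_nonneg measureReal_nonneg _)]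
  refine Finset.sum_congr rfl fun u _ => ?_
  set v := List.ofFn u
  rw [ENNReal.ofReal_mul (Real.rpow_nonneg (hpos v).le _),
    ← ENNReal.ofReal_rpow_of_pos (hpos v),
    ← ENNReal.ofReal_rpow_of_nonneg measureReal_nonneg (by linarith), ofReal_measureReal,
    ENNReal.mul_rpow_of_nonneg _ _ (by linarith : 0 ≤ q - 1), invSvf, ENNReal.inv_rpow,
    ← ENNReal.rpow_neg, neg_sub, mul_assoc]
  congr 1
  conv_lhs => rw [← ENNReal.rpow_one (μ (cyl v)), ← ENNReal.rpow_mul, one_mul]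
  rw [← ENNReal.rpow_add_of_nonneg _ _ (by linarith) zero_le_one, sub_add_cancel]

end MomentSum

end AlmostSelfAffine

end

theorem theorem7p4 {N m : ℕ} (hN : 0 < N)
    (T : Fin m → EuclideanSpace ℝ (Fin N) →L[ℝ] EuclideanSpace ℝ (Fin N))
    (hT : ∀ i, ‖T i‖ < 1) (hT' : ∀ i, (T i).det ≠ 0)
    (μ : MeasureTheory.Measure (AlmostSelfAffine.Code m)) [MeasureTheory.IsFiniteMeasure μ]
    (q : ℝ) (hq : 1 < q) (n : ℕ) (hn : q - 1 ≤ n) (hn' : (n : ℝ) ≤ q)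
    (s : ℝ) (hs : 0 < s)
    (hdecay : ∃ c r : ℝ, 0 < r ∧ r < 1 ∧
      ∀ k : ℕ, AlmostSelfAffine.momentSum T μ s q k ≤ c * r ^ k) :
    AlmostSelfAffine.multiEnergy T μ s q n < ⊤ := by
  obtain ⟨c, r, hr, hr1, hcr⟩ := hdecay
  have hp : 0 < q - 1 := sub_pos.2 hq
  -- The lower bound on `n` enters only through n > 0.
  have hn0 : (0 : ℝ) < n := hp.trans_le hn
  have hdecay' : ∀ k, ∫⁻ x, (AlmostSelfAffine.invSvf T s (AlmostSelfAffine.curtail x k) *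
      μ (AlmostSelfAffine.cyl (AlmostSelfAffine.curtail x k))) ^ (q - 1) ∂μ ≤
      ENNReal.ofReal c * ENNReal.ofReal r ^ k := by
    intro k
    rw [AlmostSelfAffine.lintegral_invSvf_mul_measure_rpow hT' μ hq, ← ENNReal.ofReal_pow hr.le,
      ← ENNReal.ofReal_mul' (pow_nonneg hr.le k)]
    exact ENNReal.ofReal_le_ofReal (hcr k)
  -- With trivial weights of degree 0 the total degree is the number `n` of edges, and n ≤ q is the
  -- required bound by p + 1.
  obtain ⟨-, C, hC, H, hH, hHi, hle⟩ := AlmostSelfAffine.WeightBound.lintegral_treeWeight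
    (n := n) (F := fun _ _ => 1) (e := fun _ => 0) hp ENNReal.ofReal_ne_top hr hr1 hdecay'
    (fun _ => AlmostSelfAffine.WeightBound.one μ (q - 1)) (by simpa using hn')
  simp only [Finset.prod_const_one, one_mul, Finset.sum_const_zero, add_zero] at hle
  have hexp : 0 ≤ (q - 1) / n := div_nonneg hp.le hn0.le
  refine lt_of_le_of_lt (lintegral_mono (g := fun j => C ^ ((q - 1) / n) * H j) fun j => ?_) ?_
  · calc (∫⁻ i : Fin n → AlmostSelfAffine.Code m,
        (ENNReal.ofReal (AlmostSelfAffine.multiKernel T s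
          (Fin.snoc (α := fun _ => AlmostSelfAffine.Code m) i j)))⁻¹
          ∂(Measure.pi fun _ => μ)) ^ ((q - 1) / (n : ℝ))
        ≤ (C * H j ^ ((n : ℝ) / (q - 1))) ^ ((q - 1) / (n : ℝ)) :=
          ENNReal.rpow_le_rpow ((lintegral_mono fun i =>
            AlmostSelfAffine.inv_multiKernel_le_treeWeight hT hT' _).trans (hle j)) hexp
      _ = C ^ ((q - 1) / n) * H j := by
          rw [ENNReal.mul_rpow_of_nonneg _ _ hexp, ← ENNReal.rpow_mul,
            div_mul_div_cancel₀ hp.ne', div_self hn0.ne', ENNReal.rpow_one]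
  · rw [lintegral_const_mul _ hH]
    exact ENNReal.mul_lt_top (ENNReal.rpow_lt_top_of_nonneg hexp hC) hHi.lt_top
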